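/- Let $\rho\in(0,1)$ and let $f_0,f_1$ be probability densities with respect to a common $\sigma$-finite measure, with Kullback--Leibler divergence $D(f_1\|f_0)=\int f_1\log(f_1/f_0)<\infty$. Let $t$ be a random change point with $P(t=m)=\rho(1-\rho)^{m-1}$, $m=1,2,\dots$, and let $X_1,X_2,\dots$ be observations such that, given $t=m$, they are independent, $X_n$ having density $f_0$ for $n<m$ and density $f_1$ for $n\ge m$. Only the observations at the deterministic integer times $0=V_0<V_1<V_2<\cdots$ are taken. Let $\pi_n=P(t\le n\mid \mathcal F_n)$, where $\mathcal F_n$ is the $\sigma$-algebra generated by those $X_{V_i}$, $i\ge1$, with $V_i\le n$. For $\eta\in(0,1)$ put $$T=\inf\{n\ge1:\pi_n\ge1-\eta\},\qquad \Gamma=\inf\{n\ge1:\pi_{V_n}\ge1-\eta\},\qquad \gamma=\inf\{n\ge1:V_n\ge t\},$$ and let $\mathrm{ADD}=E[\max\{0,T-t\}]$. Assume that (i) there is a finite $\mathcal B\ge1$ with $V_n-V_{n-1}\le\mathcal B$ for all $n\ge1$; (ii) there is $\zeta\in[1,\mathcal B]$ such that $\zeta^{(N)}:=V_N/N\to\zeta$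 as $N\to\infty$; (iii) $E[\zeta^{(\Gamma)}\max\{0,\Gamma-\gamma\}]=\zeta\,E[\max\{0,\Gamma-\gamma\}]\,(1+o(1))$ as $\eta\to0$. Then, as $\eta\to0$, $$\mathrm{ADD}\le\frac{|\log\eta|}{\frac1\zeta D(f_1\|f_0)+|\log(1-\rho)|}\,(1+o(1)).$$ -/

import Mathlib

open MeasureTheory ProbabilityTheory Filter Topology
open scoped ENNReal

namespace ChangePoint

/-- Bayesian single change-point model on the probability space `(Ω, P)`: the change point `t` is
geometric with parameter `ρ` on `{1, 2, …}` and, given `t = m`, the observations `X 1, X 2, …` are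
independent, `X n` having density `f₀` for `n < m` and density `f₁` for `n ≥ m`, with respect to
the reference measure `lam`. (The value `X 0` plays no role.) -/
structure IsModel {Ω E : Type*} [MeasurableSpace Ω] [MeasurableSpace E] (P : Measure Ω)
    (lam : Measure E) (f₀ f₁ : E → ℝ≥0∞) (ρ : ℝ) (t : Ω → ℕ) (X : ℕ → Ω → E) : Prop where
  measurable_t : Measurable t
  measurable_X : ∀ n, Measurable (X n)
  prior : ∀ m : ℕ, 1 ≤ m → P {ω | t ω = m} = ENNReal.ofReal (ρ * (1 - ρ) ^ (m - 1))
  indep : ∀ m : ℕ, 1 ≤ m → iIndepFun (fun n : ℕ => X (n + 1)) (P[|{ω | t ω = m}])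
  law_before : ∀ m n : ℕ, 1 ≤ n → n < m →
    Measure.map (X n) (P[|{ω | t ω = m}]) = lam.withDensity f₀
  law_after : ∀ m n : ℕ, 1 ≤ m → m ≤ n →
    Measure.map (X n) (P[|{ω | t ω = m}]) = lam.withDensity f₁

/-- The `σ`-algebra generated by the observations `X (V i)`, `i ≥ 1`, taken up to time `n`. -/
def observed {Ω E : Type*} [MeasurableSpace E] (X : ℕ → Ω → E) (V : ℕ → ℕ) (n : ℕ) :
    MeasurableSpace Ω :=
  ⨆ (i : ℕ) (_ : 1 ≤ i ∧ V i ≤ n), MeasurableSpace.comap (X (V i)) inferInstance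

/-- The posterior probability of `{t ≤ n}` given the observations taken up to time `n`. -/
noncomputable def posterior {Ω E : Type*} [MeasurableSpace Ω] [MeasurableSpace E] (P : Measure Ω)
    (t : Ω → ℕ) (X : ℕ → Ω → E) (V : ℕ → ℕ) (n : ℕ) : Ω → ℝ :=
  P⟦{ω | t ω ≤ n} | observed X V n⟧

/-- The least integer `n ≥ 1` with `p n`; it is `⊤` if there is none. -/
noncomputable def firstIndex (p : ℕ → Prop) : ℕ∞ :=
  ⨅ (n : ℕ) (_ : 1 ≤ n ∧ p n), (n : ℕ∞)

/-- The stopping rule `T = inf {n ≥ 1 : π_n ≥ 1 - η}`. -/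
noncomputable def stopT {Ω E : Type*} [MeasurableSpace Ω] [MeasurableSpace E] (P : Measure Ω)
    (t : Ω → ℕ) (X : ℕ → Ω → E) (V : ℕ → ℕ) (η : ℝ) (ω : Ω) : ℕ∞ :=
  firstIndex fun n => 1 - η ≤ posterior P t X V n ω

/-- The stopping rule `Γ = inf {n ≥ 1 : π_{V_n} ≥ 1 - η}`, which counts only observation times. -/
noncomputable def stopΓ {Ω E : Type*} [MeasurableSpace Ω] [MeasurableSpace E] (P : Measure Ω)
    (t : Ω → ℕ) (X : ℕ → Ω → E) (V : ℕ → ℕ) (η : ℝ) (ω : Ω) : ℕ∞ :=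
  firstIndex fun n => 1 - η ≤ posterior P t X V (V n) ω

/-- The change point `γ = inf {n ≥ 1 : V_n ≥ t}`, which counts only observation times. -/
noncomputable def changeγ {Ω : Type*} (t : Ω → ℕ) (V : ℕ → ℕ) (ω : Ω) : ℕ∞ :=
  firstIndex fun n => t ω ≤ V n

/-- The delay `max {0, a - b}` (subtraction in `ℕ∞` truncates at `0`). -/
noncomputable def delay (a b : ℕ∞) : ℝ≥0∞ :=
  ((a - b : ℕ∞) : ℝ≥0∞)

/-- The average detection delay `E[max {0, T - t}]`. -/
noncomputable def ADD {Ω E : Type*} [MeasurableSpace Ω] [MeasurableSpace E] (P : Measure Ω)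
    (t : Ω → ℕ) (X : ℕ → Ω → E) (V : ℕ → ℕ) (η : ℝ) : ℝ≥0∞ :=
  ∫⁻ ω, delay (stopT P t X V η ω) (t ω : ℕ∞) ∂P

/-- The average length `V_N / N` of the first `N` sampling intervals. -/
noncomputable def meanGap (V : ℕ → ℕ) (N : ℕ) : ℝ :=
  (V N : ℝ) / N

/-- `meanGap` at a possibly infinite index; at infinity it is the limiting mean gap. -/
noncomputable def meanGapAt (V : ℕ → ℕ) : ℕ∞ → ℝ≥0∞
  | some N => ENNReal.ofReal (meanGap V N)
  | none => limsup (fun N => ENNReal.ofReal (meanGap V N)) atTop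

end ChangePoint

namespace ChangePoint

/-! Given `t = m`, keep only the single term `t = m` of the posterior. By Bayes, the posterior odds
of `t ≤ V N` are at least the prior weight of `m` times the likelihood ratio, divided by `(1 - ρ) ^
V N`, which bounds `P (t > V N)`. So the threshold is passed once the log-likelihood ratios since
`m`, plus `|log (1 - ρ)| * V N`, exceed `|log η|` plus a term affine in `m`. Since `V N ≥ β * N - C`
for `β` slightly below `ζ`, this follows from the passage over a level `b` of a random walk with
steps `llr + |log (1 - ρ)| * β`. Truncating the steps above at `M` bounds the overshoot, and Wald's
identity (`tsum_measure_belowLevel_le`) bounds the mean passage index by `(b + O(1)) / μ`, with `μ`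
the mean step. Turning indices into times with `V N ≤ α * N + C` and averaging over `m`, whose prior
mean is finite, gives `ADD ≤ (α / μ) * |log η| + K` (`IsModel.ADD_le`). As `α, β → ζ` and `M → ∞`,
the slope tends to `ζ / (D + ζ * |log (1 - ρ)|)`. -/

/-! ### Densities of finite product measures -/

/-- A product of measures with densities is the product measure with the product density. -/
theorem pi_withDensity {ι E : Type*} [Fintype ι] [MeasurableSpace E] (ν : ι → Measure E)
    [∀ i, IsProbabilityMeasure (ν i)] (g : ι → E → ℝ≥0∞) (hg : ∀ i, Measurable (g i))
    [∀ i, IsProbabilityMeasure ((ν i).withDensity (g i))] :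
    Measure.pi (fun i => (ν i).withDensity (g i)) =
      (Measure.pi ν).withDensity (fun x => ∏ i, g i (x i)) := by
  refine Measure.pi_eq fun s hs => ?_
  rw [withDensity_apply _ (MeasurableSet.univ_pi hs), ← lintegral_indicator (MeasurableSet.univ_pi hs)]
  have h : ∀ x : ι → E, (Set.univ.pi s).indicator (fun x => ∏ i, g i (x i)) x =
      ∏ i, (s i).indicator (g i) (x i) := by
    intro x
    by_cases hx : x ∈ Set.univ.pi s
    · rw [Set.indicator_of_mem hx]
      exact Finset.prod_congr rfl fun i _ => (Set.indicator_of_mem (hx i trivial) _).symm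
    · rw [Set.indicator_of_notMem hx]
      simp only [Set.mem_pi, Set.mem_univ, true_implies, not_forall] at hx
      obtain ⟨i, hi⟩ := hx
      exact (Finset.prod_eq_zero (Finset.mem_univ i) (Set.indicator_of_notMem hi _)).symm
  simp_rw [h]
  have hm : ∀ i, Measurable ((s i).indicator (g i)) := fun i => (hg i).indicator (hs i)
  rw [lintegral_prod_eq_prod_lintegral_of_indepFun Finset.univ
    (fun i (x : ι → E) => (s i).indicator (g i) (x i))
    (iIndepFun_pi (X := fun i => (s i).indicator (g i)) fun i => (hm i).aemeasurable)
    (fun i => (hm i).comp (measurable_pi_apply i))]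
  refine Finset.prod_congr rfl fun i _ => ?_
  rw [withDensity_apply _ (hs i), ← lintegral_indicator (hs i)]
  exact (measurePreserving_eval ν i).lintegral_comp (hm i)

/-! ### First passage of a random walk -/

/-- The event that none of the partial sums of length at most `j` reaches the level `b`. -/
def belowLevel {Ω : Type*} (Y : ℕ → Ω → ℝ) (b : ℝ) (j : ℕ) : Set Ω :=
  {ω | ∀ i ≤ j, ∑ l ∈ Finset.range i, Y l ω < b}

theorem measurableSet_belowLevel {Ω : Type*} {m : MeasurableSpace Ω} {Y : ℕ → Ω → ℝ} {j : ℕ}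
    (hY : ∀ l < j, Measurable (Y l)) (b : ℝ) : MeasurableSet (belowLevel Y b j) := by
  have : belowLevel Y b j = ⋂ (i : ℕ) (_ : i ≤ j), {ω | ∑ l ∈ Finset.range i, Y l ω < b} := by
    ext ω; simp [belowLevel]
  rw [this]
  refine MeasurableSet.iInter fun i => MeasurableSet.iInter fun hi => ?_
  refine measurableSet_lt (Finset.measurable_sum _ fun l hl => hY l ?_) measurable_const
  exact (Finset.mem_range.1 hl).trans_le hi

/-- The events decrease in `j`, so the sum is the walk stopped at its first passage: below `b`
before the last step, which adds at most `M`. -/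
theorem sum_indicator_belowLevel_le {Ω : Type*} {Y : ℕ → Ω → ℝ} {b M : ℝ} (hb : 0 ≤ b) (hM0 : 0 ≤ M)
    (hM : ∀ j ω, Y j ω ≤ M) (n : ℕ) (ω : Ω) :
    ∑ j ∈ Finset.range n, (belowLevel Y b j).indicator (Y j) ω ≤ b + M := by
  induction n with
  | zero => simpa using add_nonneg hb hM0
  | succ n ih =>
    rw [Finset.sum_range_succ]
    by_cases h : ω ∈ belowLevel Y b n
    · rw [Set.indicator_of_mem h]
      have : ∑ j ∈ Finset.range n, (belowLevel Y b j).indicator (Y j) ω =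
          ∑ j ∈ Finset.range n, Y j ω := by
        refine Finset.sum_congr rfl fun j hj => Set.indicator_of_mem ?_ _
        exact fun i hi => h i (hi.trans (Finset.mem_range.1 hj).le)
      rw [this]
      exact add_le_add (h n le_rfl).le (hM n ω)
    · rwa [Set.indicator_of_notMem h, add_zero]

/-- Expected first passage time of a random walk with positive drift and steps bounded above, by
Wald's identity. -/
theorem tsum_measure_belowLevel_le {Ω : Type*} [MeasurableSpace Ω] {P : Measure Ω}
    [IsProbabilityMeasure P] {Y : ℕ → Ω → ℝ} (hY : ∀ j, Measurable (Y j)) (hind : iIndepFun Y P)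
    {b M μ : ℝ} (hb : 0 ≤ b) (hM0 : 0 ≤ M) (hμ : 0 < μ) (hint : ∀ j, Integrable (Y j) P)
    (hmean : ∀ j, ∫ ω, Y j ω ∂P = μ) (hM : ∀ j ω, Y j ω ≤ M) :
    ∑' j, P (belowLevel Y b j) ≤ ENNReal.ofReal ((b + M) / μ) := by
  have hG : ∀ j, MeasurableSet (belowLevel Y b j) := fun j =>
    measurableSet_belowLevel (fun l _ => hY l) b
  -- The event depends only on `Y 0, …, Y (j - 1)`, hence is independent of `Y j`.
  have key : ∀ j, ∫ ω in belowLevel Y b j, Y j ω ∂P = P.real (belowLevel Y b j) * μ := by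
    intro j
    have hind' := hind.indepFun_finset (Finset.range j) {j} (by simp) hY
    have hind2 : IndepFun (fun ω (i : Finset.range j) => Y i ω) (Y j) P :=
      hind'.comp measurable_id (measurable_pi_apply (⟨j, by simp⟩ : ({j} : Finset ℕ)))
    have hmeas : Measurable (fun ω (i : Finset.range j) => Y i ω) :=
      measurable_pi_lambda _ fun i => hY i
    have := Indep.setIntegral_eq_mul (f := id) (A := belowLevel Y b j) hmeas.comap_le hind2
      (hY j).aemeasurable (measurableSet_belowLevel (fun l hl => ?_) b)
      measurable_id.aestronglyMeasurable
    · simpa [hmean j] using this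
    · exact (measurable_pi_apply (⟨l, by simpa using hl⟩ : Finset.range j)).comp
        (comap_measurable (fun ω (i : Finset.range j) => Y i ω))
  -- Bounding partial sums uniformly avoids assuming that the passage time is finite.
  rw [ENNReal.tsum_eq_iSup_nat]
  refine iSup_le fun n => ?_
  have h1 : (∑ j ∈ Finset.range n, P.real (belowLevel Y b j)) * μ ≤ b + M := by
    calc (∑ j ∈ Finset.range n, P.real (belowLevel Y b j)) * μ
        = ∑ j ∈ Finset.range n, ∫ ω, (belowLevel Y b j).indicator (Y j) ω ∂P := by
          rw [Finset.sum_mul]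
          refine Finset.sum_congr rfl fun j _ => ?_
          rw [integral_indicator (hG j), key]
      _ = ∫ ω, ∑ j ∈ Finset.range n, (belowLevel Y b j).indicator (Y j) ω ∂P :=
          (integral_finsetSum _ fun j _ => (hint j).indicator (hG j)).symm
      _ ≤ ∫ _, b + M ∂P :=
          integral_mono (integrable_finsetSum _ fun j _ => (hint j).indicator (hG j))
            (integrable_const _) fun ω => sum_indicator_belowLevel_le hb hM0 hM n ω
      _ = b + M := by simp
  have h2 : ∑ j ∈ Finset.range n, P (belowLevel Y b j) =
      ENNReal.ofReal (∑ j ∈ Finset.range n, P.real (belowLevel Y b j)) := by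
    rw [ENNReal.ofReal_sum_of_nonneg fun _ _ => measureReal_nonneg]
    exact Finset.sum_congr rfl fun j _ => (ofReal_measureReal (measure_ne_top _ _)).symm
  rw [h2]
  exact ENNReal.ofReal_le_ofReal ((le_div_iff₀ hμ).2 h1)

/-! ### Prior of the change point and joint law of the observations -/

variable {Ω E : Type*} [MeasurableSpace Ω] [MeasurableSpace E]

namespace IsModel

variable {P : Measure Ω} {lam : Measure E} {f₀ f₁ : E → ℝ≥0∞} {ρ : ℝ} {t : Ω → ℕ} {X : ℕ → Ω → E}

theorem measurableSet_eq (h : IsModel P lam f₀ f₁ ρ t X) (m : ℕ) : MeasurableSet {ω | t ω = m} :=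
  h.measurable_t (measurableSet_singleton m)

/-- The complement of the interval also contains the value `0`, whose mass the model does not
prescribe. Letting `n → ∞` therefore shows that `t = 0` is null. -/
theorem measure_notMem_Icc [IsProbabilityMeasure P] (h : IsModel P lam f₀ f₁ ρ t X)
    (hρ : ρ ∈ Set.Ioo (0 : ℝ) 1) (n : ℕ) :
    P {ω | t ω ∉ Finset.Icc 1 n} = ENNReal.ofReal ((1 - ρ) ^ n) := by
  have hρ' : 0 ≤ 1 - ρ := by linarith [hρ.2]
  have hc : {ω | t ω ∉ Finset.Icc 1 n} = (⋃ m ∈ Finset.Icc 1 n, {ω | t ω = m})ᶜ := by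
    ext ω
    simp only [Set.mem_ofPred_eq, Set.mem_compl_iff, Set.mem_iUnion, not_exists]
    exact ⟨fun hω m hm he => hω (he ▸ hm), fun hω hm => hω _ hm rfl⟩
  have hsum : P (⋃ m ∈ Finset.Icc 1 n, {ω | t ω = m}) = ENNReal.ofReal (1 - (1 - ρ) ^ n) := by
    rw [measure_biUnion_finset]
    · rw [Finset.sum_congr rfl fun m hm => h.prior m (Finset.mem_Icc.1 hm).1,
        ← ENNReal.ofReal_sum_of_nonneg fun m _ => mul_nonneg hρ.1.le (pow_nonneg hρ' _)]
      congr 1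
      clear hc
      induction n with
      | zero => simp
      | succ n ih =>
        rw [Finset.sum_Icc_succ_top (by omega), ih]
        simp only [add_tsub_cancel_right, pow_succ]
        ring
    · intro a _ b _ hab
      exact Set.disjoint_left.2 fun ω ha hb => hab (ha.symm.trans hb)
    · exact fun m _ => h.measurableSet_eq m
  rw [hc, prob_compl_eq_one_sub (Finset.measurableSet_biUnion _ fun m _ => h.measurableSet_eq m),
    hsum, ← ENNReal.ofReal_one, ← ENNReal.ofReal_sub _ (by
      have := pow_le_one₀ (n := n) hρ' (by linarith [hρ.1]); linarith)]
  congr 1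
  ring

theorem measure_lt_le [IsProbabilityMeasure P] (h : IsModel P lam f₀ f₁ ρ t X)
    (hρ : ρ ∈ Set.Ioo (0 : ℝ) 1) (n : ℕ) :
    P {ω | n < t ω} ≤ ENNReal.ofReal ((1 - ρ) ^ n) := by
  rw [← h.measure_notMem_Icc hρ n]
  exact measure_mono fun ω (hω : n < t ω) => by simp; omega

theorem measure_eq_zero [IsProbabilityMeasure P] (h : IsModel P lam f₀ f₁ ρ t X)
    (hρ : ρ ∈ Set.Ioo (0 : ℝ) 1) : P {ω | t ω = 0} = 0 := by
  have hle : ∀ n : ℕ, P {ω | t ω = 0} ≤ ENNReal.ofReal ((1 - ρ) ^ n) := fun n => by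
    rw [← h.measure_notMem_Icc hρ n]
    exact measure_mono fun ω (hω : t ω = 0) => by simp [hω]
  have hlim : Tendsto (fun n : ℕ => ENNReal.ofReal ((1 - ρ) ^ n)) atTop (𝓝 0) := by
    rw [← ENNReal.ofReal_zero]
    exact ENNReal.tendsto_ofReal
      (tendsto_pow_atTop_nhds_zero_of_lt_one (by linarith [hρ.2]) (by linarith [hρ.1]))
  exact le_antisymm (ge_of_tendsto' hlim hle) zero_le

theorem measure_eq_ne_zero (h : IsModel P lam f₀ f₁ ρ t X) (hρ : ρ ∈ Set.Ioo (0 : ℝ) 1) {m : ℕ}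
    (hm : 1 ≤ m) : P {ω | t ω = m} ≠ 0 := by
  rw [h.prior m hm]
  exact (ENNReal.ofReal_pos.2 (mul_pos hρ.1 (pow_pos (by linarith [hρ.2]) _))).ne'

/-- Joint law, given the change point, of the first `N` observations taken. -/
theorem map_cond_eq_pi [IsProbabilityMeasure P] (h : IsModel P lam f₀ f₁ ρ t X)
    (hρ : ρ ∈ Set.Ioo (0 : ℝ) 1) {V : ℕ → ℕ} (hV0 : V 0 = 0) (hV : StrictMono V) {m : ℕ}
    (hm : 1 ≤ m) (N : ℕ) :
    Measure.map (fun ω (i : Fin N) => X (V (i + 1)) ω) (P[|{ω | t ω = m}]) =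
      Measure.pi fun i : Fin N =>
        if V (i + 1) < m then lam.withDensity f₀ else lam.withDensity f₁ := by
  have hpos : ∀ i, 1 ≤ V (i + 1) := fun i => by
    have := hV (Nat.succ_pos i); simp only [hV0] at this; exact this
  have := cond_isProbabilityMeasure (h.measure_eq_ne_zero hρ hm)
  -- Independence in the model is indexed by `n ↦ X (n + 1)`, hence the shift by one.
  have hinj : Function.Injective fun i : Fin N => V (i + 1) - 1 := by
    intro i j hij
    have h1 := hpos i
    have h2 := hpos j
    have : V (i + 1) = V (j + 1) := by simp only at hij; omega
    exact Fin.ext (Nat.succ_injective (hV.injective this))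
  have hind := (h.indep m hm).precomp hinj
  have heq : (fun i : Fin N => X (V (i + 1) - 1 + 1)) = fun i : Fin N => X (V (i + 1)) := by
    funext i; rw [Nat.sub_add_cancel (hpos i)]
  rw [heq] at hind
  rw [hind.map_fun_eq_pi_map fun i => (h.measurable_X _).aemeasurable]
  congr 1
  funext i
  split_ifs with hi
  · exact h.law_before m _ (hpos i) hi
  · exact h.law_after m _ hm (not_lt.1 hi)

end IsModel

/-! ### Lower bound for the posterior -/

theorem observed_eq_comap {Ω E : Type*} [MeasurableSpace E] {X : ℕ → Ω → E} {V : ℕ → ℕ} (hV : StrictMono V) (N : ℕ) :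
    observed X V (V N) =
      MeasurableSpace.comap (fun ω (i : Fin N) => X (V (i + 1)) ω) MeasurableSpace.pi := by
  rw [MeasurableSpace.pi, MeasurableSpace.comap_iSup]
  simp only [MeasurableSpace.comap_comp, Function.comp_def, observed]
  apply le_antisymm
  · refine iSup₂_le fun i hi => ?_
    have hiN : i ≤ N := hV.le_iff_le.1 hi.2
    refine le_trans (le_of_eq ?_) (le_iSup _ (⟨i - 1, by omega⟩ : Fin N))
    simp [Nat.sub_add_cancel hi.1]
  · refine iSup_le fun i => ?_
    exact le_iSup₂_of_le ((i : ℕ) + 1) ⟨by omega, hV.monotone (by omega)⟩ le_rfl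

/-- A set of likelihood ratio at least `κ` between `t = m` and `t > V N` satisfies the
corresponding inequality between probabilities. -/
theorem IsModel.mul_measure_inter_le {P : Measure Ω} [IsProbabilityMeasure P] {lam : Measure E}
    {f₀ f₁ : E → ℝ≥0∞} {ρ : ℝ} {t : Ω → ℕ} {X : ℕ → Ω → E} (h : IsModel P lam f₀ f₁ ρ t X)
    (hρ : ρ ∈ Set.Ioo (0 : ℝ) 1) [IsProbabilityMeasure (lam.withDensity f₀)]
    [IsProbabilityMeasure (lam.withDensity f₁)]
    (hac : lam.withDensity f₁ ≪ lam.withDensity f₀) {V : ℕ → ℕ} (hV0 : V 0 = 0)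
    (hV : StrictMono V) {m N : ℕ} (hm : 1 ≤ m) {κ : ℝ} (hκ : 0 ≤ κ) {S : Set (Fin N → E)}
    (hS : MeasurableSet S)
    (hSκ : ∀ x ∈ S, ENNReal.ofReal (κ * (1 - ρ) ^ V N) ≤ ENNReal.ofReal (ρ * (1 - ρ) ^ (m - 1)) *
      ∏ i : Fin N, if V (i + 1) < m then 1 else
        (lam.withDensity f₁).rnDeriv (lam.withDensity f₀) (x i)) :
    ENNReal.ofReal κ * P (((fun ω (i : Fin N) => X (V (i + 1)) ω) ⁻¹' S) ∩ {ω | V N < t ω}) ≤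
      P (((fun ω (i : Fin N) => X (V (i + 1)) ω) ⁻¹' S) ∩ {ω | t ω = m}) := by
  set μ₀ := lam.withDensity f₀
  set μ₁ := lam.withDensity f₁
  set Z : Ω → Fin N → E := fun ω i => X (V (i + 1)) ω with hZ
  have hZm : Measurable Z := measurable_pi_lambda _ fun i => h.measurable_X _
  have hinter : ∀ m', 1 ≤ m' → P (Z ⁻¹' S ∩ {ω | t ω = m'}) = P {ω | t ω = m'} *
      Measure.pi (fun i : Fin N => if V (i + 1) < m' then μ₀ else μ₁) S := by
    intro m' hm'
    rw [← h.map_cond_eq_pi hρ hV0 hV hm' N, Measure.map_apply hZm hS, Set.inter_comm,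
      ← cond_mul_eq_inter (h.measurableSet_eq m'), mul_comm]
  -- For every change point beyond `V N`, the first `N` observations all have density `f₀`, so their
  -- conditional law is the same and the prior masses add up.
  have hQ : P (Z ⁻¹' S ∩ {ω | V N < t ω}) =
      P {ω | V N < t ω} * Measure.pi (fun _ : Fin N => μ₀) S := by
    have hU : {ω | V N < t ω} = ⋃ k : ℕ, {ω | t ω = V N + 1 + k} := by
      ext ω
      simp only [Set.mem_ofPred_eq, Set.mem_iUnion]
      exact ⟨fun hω => ⟨t ω - (V N + 1), by omega⟩, fun ⟨k, hk⟩ => by omega⟩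
    have hd : Pairwise (Function.onFun Disjoint fun k : ℕ => {ω | t ω = V N + 1 + k}) := by
      intro a b hab
      refine Set.disjoint_left.2 fun ω ha hb => hab ?_
      simp only [Set.mem_ofPred_eq] at ha hb
      omega
    rw [hU, Set.inter_iUnion, measure_iUnion (fun a b hab =>
      (hd hab).mono Set.inter_subset_right Set.inter_subset_right)
      (fun k => (hZm hS).inter (h.measurableSet_eq _)), measure_iUnion hd
      (fun k => h.measurableSet_eq _), ← ENNReal.tsum_mul_right]
    refine tsum_congr fun k => ?_
    rw [hinter _ (by omega)]
    congr 3
    funext i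
    rw [if_pos]
    have : V (i + 1) ≤ V N := hV.monotone (by omega)
    omega
  have hpi : Measure.pi (fun i : Fin N => if V (i + 1) < m then μ₀ else μ₁) =
      (Measure.pi fun _ : Fin N => μ₀).withDensity fun x =>
        ∏ i : Fin N, if V (i + 1) < m then 1 else μ₁.rnDeriv μ₀ (x i) := by
    have e : ∀ i : Fin N, μ₀.withDensity (fun y => if V (i + 1) < m then 1 else μ₁.rnDeriv μ₀ y) =
        if V (i + 1) < m then μ₀ else μ₁ := by
      intro i
      split_ifs
      · exact withDensity_one
      · exact Measure.withDensity_rnDeriv_eq _ _ hac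
    have hp : ∀ i : Fin N, IsProbabilityMeasure
        (μ₀.withDensity (fun y => if V (i + 1) < m then 1 else μ₁.rnDeriv μ₀ y)) := by
      intro i
      rw [e i]
      split_ifs <;> infer_instance
    rw [← pi_withDensity (fun _ : Fin N => μ₀)
      (fun i y => if V (i + 1) < m then 1 else μ₁.rnDeriv μ₀ y)]
    · simp_rw [e]
    · intro i
      split_ifs
      · exact measurable_const
      · exact Measure.measurable_rnDeriv _ _
  calc ENNReal.ofReal κ * P (Z ⁻¹' S ∩ {ω | V N < t ω})
      ≤ ENNReal.ofReal (κ * (1 - ρ) ^ V N) * Measure.pi (fun _ : Fin N => μ₀) S := by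
        rw [hQ, ENNReal.ofReal_mul hκ, mul_assoc]
        gcongr
        exact h.measure_lt_le hρ _
    _ = ∫⁻ _ in S, ENNReal.ofReal (κ * (1 - ρ) ^ V N) ∂Measure.pi (fun _ : Fin N => μ₀) := by
        rw [setLIntegral_const]
    _ ≤ ∫⁻ x in S, ENNReal.ofReal (ρ * (1 - ρ) ^ (m - 1)) *
          ∏ i : Fin N, (if V (i + 1) < m then 1 else μ₁.rnDeriv μ₀ (x i))
            ∂Measure.pi (fun _ : Fin N => μ₀) := setLIntegral_mono' hS hSκ
    _ = P (Z ⁻¹' S ∩ {ω | t ω = m}) := by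
        rw [lintegral_const_mul' _ _ ENNReal.ofReal_ne_top, hinter m hm, h.prior m hm, hpi,
          withDensity_apply _ hS]

/-- Bayes' rule without a posterior formula: on the observed event where the ratio is large but the
posterior is below `1 - η`, integrating the posterior contradicts `IsModel.mul_measure_inter_le`
unless the event is null. The factor `(1 - η) / η` is the odds at posterior `1 - η`. -/
theorem IsModel.le_posterior {P : Measure Ω} [IsProbabilityMeasure P] {lam : Measure E}
    {f₀ f₁ : E → ℝ≥0∞} {ρ : ℝ} {t : Ω → ℕ} {X : ℕ → Ω → E} (h : IsModel P lam f₀ f₁ ρ t X)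
    (hρ : ρ ∈ Set.Ioo (0 : ℝ) 1) [IsProbabilityMeasure (lam.withDensity f₀)]
    [IsProbabilityMeasure (lam.withDensity f₁)]
    (hac : lam.withDensity f₁ ≪ lam.withDensity f₀) {V : ℕ → ℕ} (hV0 : V 0 = 0)
    (hV : StrictMono V) {m N : ℕ} (hm : 1 ≤ m) (hmN : m ≤ V N) {η : ℝ} (hη : η ∈ Set.Ioo (0 : ℝ) 1) :
    ∀ᵐ ω ∂P, ENNReal.ofReal ((1 - η) / η * (1 - ρ) ^ V N) ≤
        ENNReal.ofReal (ρ * (1 - ρ) ^ (m - 1)) * ∏ i ∈ Finset.range N, (if V (i + 1) < m then 1 else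
          (lam.withDensity f₁).rnDeriv (lam.withDensity f₀) (X (V (i + 1)) ω)) →
      1 - η ≤ posterior P t X V (V N) ω := by
  set L := (lam.withDensity f₁).rnDeriv (lam.withDensity f₀) with hL
  set Z : Ω → Fin N → E := fun ω i => X (V (i + 1)) ω with hZ
  have hZm : Measurable Z := measurable_pi_lambda _ fun i => h.measurable_X _
  have hobs : observed X V (V N) = MeasurableSpace.comap Z MeasurableSpace.pi :=
    observed_eq_comap hV N
  have hle : observed X V (V N) ≤ ‹MeasurableSpace Ω› := hobs ▸ hZm.comap_le
  have hκ : 0 ≤ (1 - η) / η := div_nonneg (by linarith [hη.2]) hη.1.le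
  set S₁ : Set (Fin N → E) := {x | ENNReal.ofReal ((1 - η) / η * (1 - ρ) ^ V N) ≤
    ENNReal.ofReal (ρ * (1 - ρ) ^ (m - 1)) * ∏ i : Fin N, (if V (i + 1) < m then 1 else L (x i))}
    with hS₁
  have hS₁m : MeasurableSet S₁ := by
    refine measurableSet_le measurable_const (Measurable.const_mul ?_ _)
    refine Finset.measurable_prod _ fun i _ => ?_
    split_ifs
    · exact measurable_const
    · exact (Measure.measurable_rnDeriv _ _).comp (measurable_pi_apply i)
  have hpm : Measurable[observed X V (V N)] (posterior P t X V (V N)) :=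
    stronglyMeasurable_condExp.measurable
  have hTm : MeasurableSet[observed X V (V N)] {ω | posterior P t X V (V N) ω < 1 - η} :=
    hpm measurableSet_Iio
  obtain ⟨S₂, hS₂m, hS₂⟩ : ∃ S₂ : Set (Fin N → E), MeasurableSet S₂ ∧
      Z ⁻¹' S₂ = {ω | posterior P t X V (V N) ω < 1 - η} := by
    rw [hobs] at hTm; exact hTm
  set A := Z ⁻¹' (S₁ ∩ S₂) with hA
  have hAm : MeasurableSet[observed X V (V N)] A := by
    rw [hobs]; exact ⟨_, hS₁m.inter hS₂m, rfl⟩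
  have hAm' : MeasurableSet A := hle _ hAm
  have hkey := h.mul_measure_inter_le hρ hac hV0 hV hm hκ (hS₁m.inter hS₂m) fun x hx => hx.1
  have htm : MeasurableSet {ω | t ω ≤ V N} := h.measurable_t measurableSet_Iic
  have hreal : (1 - η) * P.real A ≤ P.real (A ∩ {ω | t ω ≤ V N}) := by
    have h1 : (1 - η) / η * P.real (A ∩ {ω | V N < t ω}) ≤ P.real (A ∩ {ω | t ω ≤ V N}) := by
      have : ENNReal.ofReal ((1 - η) / η) * P (A ∩ {ω | V N < t ω}) ≤ P (A ∩ {ω | t ω ≤ V N}) :=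
        hkey.trans (measure_mono (Set.inter_subset_inter_right _ fun ω (hω : t ω = m) => by
          simpa [hω] using hmN))
      have := ENNReal.toReal_mono (measure_ne_top _ _) this
      rwa [ENNReal.toReal_mul, ENNReal.toReal_ofReal hκ] at this
    have h2 : P.real A = P.real (A ∩ {ω | t ω ≤ V N}) + P.real (A ∩ {ω | V N < t ω}) := by
      rw [← measureReal_inter_add_sdiff (s := A) htm]
      congr 2
      ext ω; simp
    rw [div_mul_eq_mul_div, div_le_iff₀ hη.1] at h1
    rw [h2]
    linarith
  have hint : ∫ ω in A, posterior P t X V (V N) ω ∂P = P.real (A ∩ {ω | t ω ≤ V N}) := by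
    rw [posterior, setIntegral_condExp hle ((integrable_const 1).indicator htm) hAm,
      setIntegral_indicator htm]
    simp
  have hpi : Integrable (posterior P t X V (V N)) P := integrable_condExp
  have hzero : P A = 0 := by
    have hlt : ∀ ω ∈ A, 0 < 1 - η - posterior P t X V (V N) ω := fun ω hω => by
      have : ω ∈ Z ⁻¹' S₂ := hω.2
      rw [hS₂] at this
      exact sub_pos.2 this
    have hdiff : IntegrableOn (fun ω => 1 - η - posterior P t X V (V N) ω) A P :=
      ((integrable_const _).sub hpi).integrableOn
    have hi0 : ∫ ω in A, (1 - η - posterior P t X V (V N) ω) ∂P ≤ 0 := by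
      rw [integral_sub (integrable_const _) hpi.integrableOn, hint, setIntegral_const,
        smul_eq_mul]
      linarith
    by_contra hne
    refine hi0.not_gt ((setIntegral_pos_iff_support_of_nonneg_ae ?_ hdiff).2 ?_)
    · exact (ae_restrict_mem hAm').mono fun ω hω => (hlt ω hω).le
    · refine (pos_iff_ne_zero.2 hne).trans_le (measure_mono fun ω hω => ⟨(hlt ω hω).ne', hω⟩)
  filter_upwards [measure_eq_zero_iff_ae_notMem.1 hzero] with ω hω hR
  by_contra hlt
  refine hω ⟨?_, ?_⟩
  · simp only [hS₁, Set.mem_ofPred_eq]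
    rwa [Finset.prod_range (fun i => if V (i + 1) < m then 1 else L (X (V (i + 1)) ω))] at hR
  · have : ω ∈ {ω | posterior P t X V (V N) ω < 1 - η} := not_le.1 hlt
    rwa [← hS₂] at this

/-! ### Linear control of the sampling times -/

theorem firstIndex_le {p : ℕ → Prop} {n : ℕ} (hn : 1 ≤ n) (hp : p n) : firstIndex p ≤ n :=
  iInf₂_le n ⟨hn, hp⟩

theorem delay_le (a b : ℕ∞) : delay a b ≤ (a : ℝ≥0∞) :=
  ENat.toENNReal_le.2 tsub_le_self

/-- The finitely many indices before the limit is `ε`-close are absorbed into `C`. -/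
theorem exists_abs_sub_le {V : ℕ → ℕ} {ζ : ℝ} (h : Tendsto (meanGap V) atTop (𝓝 ζ)) {ε : ℝ}
    (hε : 0 < ε) : ∃ C : ℝ, 0 ≤ C ∧ ∀ N : ℕ, |(V N : ℝ) - ζ * N| ≤ ε * N + C := by
  obtain ⟨N₀, hN₀⟩ := Metric.tendsto_atTop.1 h ε hε
  refine ⟨∑ N ∈ Finset.range (N₀ + 1), |(V N : ℝ) - ζ * N|,
    Finset.sum_nonneg fun _ _ => abs_nonneg _, fun N => ?_⟩
  rcases lt_or_ge N (N₀ + 1) with hN | hN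
  · have := Finset.single_le_sum (f := fun N : ℕ => |(V N : ℝ) - ζ * N|)
      (fun _ _ => abs_nonneg _) (Finset.mem_range.2 hN)
    have h2 : 0 ≤ ε * N := by positivity
    linarith
  · have hpos : (0 : ℝ) < N := by exact_mod_cast (by omega : 0 < N)
    have h1 := (hN₀ N (by omega)).le
    rw [Real.dist_eq, meanGap] at h1
    have h2 : (V N : ℝ) - ζ * N = (V N / N - ζ) * N := by field_simp
    rw [h2, abs_mul, abs_of_pos hpos]
    have h3 : 0 ≤ ∑ N ∈ Finset.range (N₀ + 1), |(V N : ℝ) - ζ * N| :=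
      Finset.sum_nonneg fun _ _ => abs_nonneg _
    nlinarith

theorem setLIntegral_eq_mul_lintegral_cond {Ω : Type*} [MeasurableSpace Ω] {P : Measure Ω}
    [IsFiniteMeasure P] {s : Set Ω} (hs : P s ≠ 0) (f : Ω → ℝ≥0∞) :
    ∫⁻ ω in s, f ω ∂P = P s * ∫⁻ ω, f ω ∂P[|s] := by
  rw [ProbabilityTheory.cond, lintegral_smul_measure, smul_eq_mul, ← mul_assoc,
    ENNReal.mul_inv_cancel hs (measure_ne_top _ _), one_mul]

/-! ### Delay given the change point -/

/-- The steps of the random walk that minorizes the log-likelihood ratio: truncated increments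
plus a drift. -/
noncomputable def truncLLR (μ ν : Measure E) (M d : ℝ) (x : E) : ℝ :=
  min (llr μ ν x) M + d

theorem measurable_truncLLR (μ ν : Measure E) (M d : ℝ) : Measurable (truncLLR μ ν M d) :=
  ((measurable_llr μ ν).min measurable_const).add_const d

theorem integrable_truncLLR {μ ν : Measure E} [IsFiniteMeasure μ] (h : Integrable (llr μ ν) μ)
    (M d : ℝ) : Integrable (truncLLR μ ν M d) μ :=
  (h.inf (integrable_const M)).add (integrable_const d)

/-- This is the posterior criterion in logarithms: the first `k` factors are `1`, and the drift
`-log (1 - ρ) * β` per step underestimates the gain from `(1 - ρ) ^ V (k + j)`, up to the constant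
`C` moved into the level. -/
theorem stopT_le_of_le_sum {P : Measure Ω} {μ₀ μ₁ : Measure E} {ρ : ℝ} {t : Ω → ℕ} {X : ℕ → Ω → E}
    (hρ : ρ ∈ Set.Ioo (0 : ℝ) 1) {V : ℕ → ℕ} (hV : StrictMono V)
    {β C : ℝ} (hβ : 0 ≤ β) (hlow : ∀ N : ℕ, β * N - C ≤ V N)
    {m k : ℕ} (hm : 1 ≤ m) (hkm : m ≤ V (k + 1)) (hk : ∀ i < k, V (i + 1) < m)
    {η : ℝ} (hη : η ∈ Set.Ioo (0 : ℝ) 1) (M : ℝ) {ω : Ω}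
    (hpost : ∀ N, m ≤ V N → ENNReal.ofReal ((1 - η) / η * (1 - ρ) ^ V N) ≤
        ENNReal.ofReal (ρ * (1 - ρ) ^ (m - 1)) * ∏ i ∈ Finset.range N, (if V (i + 1) < m then 1 else
          μ₁.rnDeriv μ₀ (X (V (i + 1)) ω)) →
      1 - η ≤ posterior P t X V (V N) ω)
    (hL : ∀ i, 0 < μ₁.rnDeriv μ₀ (X (V (k + i + 1)) ω) ∧
      μ₁.rnDeriv μ₀ (X (V (k + i + 1)) ω) < ∞)
    {j : ℕ} (hj : 1 ≤ j)
    (hsum : -Real.log η - Real.log ρ - Real.log (1 - ρ) * (m + C) ≤ ∑ l ∈ Finset.range j,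
      truncLLR μ₁ μ₀ M (-Real.log (1 - ρ) * β) (X (V (k + l + 1)) ω)) :
    stopT P t X V η ω ≤ V (k + j) := by
  have hVk : m ≤ V (k + j) := hkm.trans (hV.monotone (by omega))
  refine firstIndex_le (by omega) (hpost _ hVk ?_)
  have hρ' : 0 < 1 - ρ := by linarith [hρ.2]
  have hc : Real.log (1 - ρ) < 0 := Real.log_neg hρ' (by linarith [hρ.1])
  rw [Finset.prod_range_add, Finset.prod_eq_one fun i hi => if_pos (hk i (Finset.mem_range.1 hi)),
    one_mul]
  have hprod : ∏ l ∈ Finset.range j, (if V (k + l + 1) < m then 1 else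
      μ₁.rnDeriv μ₀ (X (V (k + l + 1)) ω)) = ENNReal.ofReal (Real.exp (∑ l ∈ Finset.range j,
        llr μ₁ μ₀ (X (V (k + l + 1)) ω))) := by
    rw [Real.exp_sum, ENNReal.ofReal_prod_of_nonneg fun _ _ => (Real.exp_pos _).le]
    refine Finset.prod_congr rfl fun l _ => ?_
    have : V (k + 1) ≤ V (k + l + 1) := hV.monotone (by omega)
    rw [if_neg (by omega), llr, Real.exp_log (ENNReal.toReal_pos (hL l).1.ne' (hL l).2.ne),
      ENNReal.ofReal_toReal (hL l).2.ne]
  rw [hprod, ← ENNReal.ofReal_mul (mul_nonneg hρ.1.le (pow_nonneg hρ'.le _))]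
  refine ENNReal.ofReal_le_ofReal ?_
  have hpow : ∀ n : ℕ, (1 - ρ) ^ n = Real.exp (n * Real.log (1 - ρ)) := fun n => by
    rw [Real.exp_nat_mul, Real.exp_log hρ']
  have hηinv : (1 - η) / η ≤ Real.exp (-Real.log η) := by
    rw [Real.exp_neg, Real.exp_log hη.1, ← one_div]
    exact div_le_div_of_nonneg_right (by linarith [hη.1]) hη.1.le
  calc (1 - η) / η * (1 - ρ) ^ V (k + j)
      ≤ Real.exp (-Real.log η) * Real.exp (V (k + j) * Real.log (1 - ρ)) := by
        rw [hpow]; gcongr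
    _ = Real.exp (-Real.log η + V (k + j) * Real.log (1 - ρ)) := (Real.exp_add _ _).symm
    _ ≤ Real.exp (Real.log ρ + (m - 1 : ℕ) * Real.log (1 - ρ) + ∑ l ∈ Finset.range j,
          llr μ₁ μ₀ (X (V (k + l + 1)) ω)) := by
        refine Real.exp_le_exp.2 ?_
        have h1 : ∑ l ∈ Finset.range j,
            truncLLR μ₁ μ₀ M (-Real.log (1 - ρ) * β) (X (V (k + l + 1)) ω) ≤
            ∑ l ∈ Finset.range j, llr μ₁ μ₀ (X (V (k + l + 1)) ω) +
              j * (-Real.log (1 - ρ) * β) := by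
          rw [← nsmul_eq_mul, ← Finset.card_range j, ← Finset.sum_const, Finset.card_range,
            ← Finset.sum_add_distrib]
          exact Finset.sum_le_sum fun l _ => add_le_add_left (min_le_left _ _) _
        have h2 : β * j - C ≤ V (k + j) := by
          refine le_trans ?_ (hlow (k + j))
          have : (0 : ℝ) ≤ k := Nat.cast_nonneg k
          push_cast
          nlinarith
        have h3 : ((m - 1 : ℕ) : ℝ) = m - 1 := by rw [Nat.cast_sub hm]; simp
        rw [h3]
        nlinarith
    _ = ρ * (1 - ρ) ^ (m - 1) * Real.exp (∑ l ∈ Finset.range j,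
          llr μ₁ μ₀ (X (V (k + l + 1)) ω)) := by
        rw [Real.exp_add, Real.exp_add, Real.exp_log hρ.1, hpow]

/-- A time that is at most `V (k + j)` once a walk has reached `b` after `j` steps is controlled
by the number of steps that the walk spends below `b`. -/
theorem toENNReal_le_tsum_indicator {Ω : Type*} {V : ℕ → ℕ} {α C b : ℝ} (hα : 0 < α) (hC : 0 ≤ C)
    (hup : ∀ N : ℕ, (V N : ℝ) ≤ α * N + C) {k m : ℕ} (hkm : k ≤ m) (hb : 0 < b)
    {Y : ℕ → Ω → ℝ} {ω : Ω} {τ : ℕ∞}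
    (hτ : ∀ j, 1 ≤ j → b ≤ ∑ l ∈ Finset.range j, Y l ω → τ ≤ V (k + j)) :
    (τ : ℝ≥0∞) ≤ ENNReal.ofReal α * (∑' j, (belowLevel Y b j).indicator 1 ω) +
      ENNReal.ofReal (α * m + C) := by
  by_cases h : ∃ j, ω ∉ belowLevel Y b j
  · obtain ⟨j₀, hnot, hmin⟩ : ∃ j₀, ω ∉ belowLevel Y b j₀ ∧ ∀ j < j₀, ω ∈ belowLevel Y b j := by
      classical
      exact ⟨Nat.find h, Nat.find_spec h, fun j hj => not_not.1 (Nat.find_min h hj)⟩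
    have hreach : b ≤ ∑ l ∈ Finset.range j₀, Y l ω := by
      simp only [belowLevel, Set.mem_ofPred_eq, not_forall, not_lt] at hnot
      obtain ⟨i, hi, hbi⟩ := hnot
      rcases hi.lt_or_eq with hlt | rfl
      · exact absurd hbi (not_le.2 (hmin i hlt i le_rfl))
      · exact hbi
    -- The empty sum is `0 < b`; a positive index is what `hτ` requires.
    have hj1 : 1 ≤ j₀ := by
      by_contra h0
      have : j₀ = 0 := by omega
      rw [this] at hreach
      simp at hreach
      linarith
    have hcount : (j₀ : ℝ≥0∞) ≤ ∑' j, (belowLevel Y b j).indicator 1 ω := by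
      refine le_trans (le_of_eq ?_) (ENNReal.sum_le_tsum (Finset.range j₀))
      rw [Finset.sum_congr rfl fun j hj => Set.indicator_of_mem (hmin j (Finset.mem_range.1 hj)) _]
      simp
    calc (τ : ℝ≥0∞) ≤ ((V (k + j₀) : ℕ∞) : ℝ≥0∞) := ENat.toENNReal_le.2 (hτ j₀ hj1 hreach)
      _ = ENNReal.ofReal (V (k + j₀)) := by simp
      _ ≤ ENNReal.ofReal (α * j₀ + (α * m + C)) := by
          refine ENNReal.ofReal_le_ofReal ((hup _).trans ?_)
          have : (k : ℝ) ≤ m := by exact_mod_cast hkm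
          push_cast
          nlinarith
      _ = ENNReal.ofReal α * j₀ + ENNReal.ofReal (α * m + C) := by
          rw [ENNReal.ofReal_add (by positivity) (by positivity), ENNReal.ofReal_mul hα.le,
            ENNReal.ofReal_natCast]
      _ ≤ _ := by gcongr
  -- If the walk never reaches `b`, the right-hand side is infinite.
  · push Not at h
    have : ∑' j, (belowLevel Y b j).indicator (1 : Ω → ℝ≥0∞) ω = ∞ := by
      simp [Set.indicator_of_mem (h _)]
    rw [this, ENNReal.mul_top (ENNReal.ofReal_pos.2 hα).ne', top_add]
    exact le_top

theorem IsModel.lintegral_delay_cond_le {P : Measure Ω} [IsProbabilityMeasure P] {lam : Measure E}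
    {f₀ f₁ : E → ℝ≥0∞} {ρ : ℝ} {t : Ω → ℕ} {X : ℕ → Ω → E} (h : IsModel P lam f₀ f₁ ρ t X)
    (hρ : ρ ∈ Set.Ioo (0 : ℝ) 1) [IsProbabilityMeasure (lam.withDensity f₀)]
    [IsProbabilityMeasure (lam.withDensity f₁)]
    (hac : lam.withDensity f₁ ≪ lam.withDensity f₀)
    (hllr : Integrable (llr (lam.withDensity f₁) (lam.withDensity f₀)) (lam.withDensity f₁))
    {V : ℕ → ℕ} (hV0 : V 0 = 0) (hV : StrictMono V)
    {α β C : ℝ} (hα : 0 < α) (hβ : 0 ≤ β) (hC : 0 ≤ C) (hlow : ∀ N : ℕ, β * N - C ≤ V N)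
    (hup : ∀ N : ℕ, (V N : ℝ) ≤ α * N + C) {M : ℝ} (hM : 0 ≤ M) {μ : ℝ} (hμ : 0 < μ)
    (hμe : ∫ x, truncLLR (lam.withDensity f₁) (lam.withDensity f₀) M (-Real.log (1 - ρ) * β) x
      ∂lam.withDensity f₁ = μ) {η : ℝ} (hη : η ∈ Set.Ioo (0 : ℝ) 1) {m : ℕ} (hm : 1 ≤ m) :
    ∫⁻ ω, delay (stopT P t X V η ω) (t ω) ∂P[|{ω | t ω = m}] ≤
      ENNReal.ofReal (α * ((-Real.log η - Real.log ρ - Real.log (1 - ρ) * (m + C) +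
        (M + -Real.log (1 - ρ) * β)) / μ) + (α * m + C)) := by
  have hpos : ∀ i, 1 ≤ V (i + 1) := fun i => by
    have := hV (Nat.succ_pos i); simp only [hV0] at this; exact this
  have hP := cond_isProbabilityMeasure (h.measure_eq_ne_zero hρ hm)
  set μ₀ := lam.withDensity f₀
  set μ₁ := lam.withDensity f₁
  set Q := P[|{ω | t ω = m}]
  have hc : Real.log (1 - ρ) < 0 := Real.log_neg (by linarith [hρ.2]) (by linarith [hρ.1])
  set d := -Real.log (1 - ρ) * β with hd
  have hd0 : 0 ≤ d := mul_nonneg (by linarith) hβ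
  set b := -Real.log η - Real.log ρ - Real.log (1 - ρ) * (m + C) with hbdef
  have hb : 0 < b := by
    have h1 := Real.log_neg hη.1 hη.2
    have h2 := Real.log_neg hρ.1 hρ.2
    have h3 : (0 : ℝ) ≤ m := Nat.cast_nonneg m
    nlinarith
  have hex : ∃ i, m ≤ V (i + 1) := ⟨m - 1, by
    rw [Nat.sub_add_cancel hm]; exact hV.le_apply⟩
  -- `k` counts the observations taken before `m`; `k ≤ m` because `V i ≥ i`.
  obtain ⟨k, hk1, hk, hkm⟩ : ∃ k, m ≤ V (k + 1) ∧ (∀ i < k, V (i + 1) < m) ∧ k ≤ m := by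
    classical
    refine ⟨Nat.find hex, Nat.find_spec hex, fun i hi => not_le.1 (Nat.find_min hex hi), ?_⟩
    refine (Nat.find_min' hex (m := m - 1) ?_).trans (Nat.sub_le _ _)
    rw [Nat.sub_add_cancel hm]; exact hV.le_apply
  have hafter : ∀ l, m ≤ V (k + l + 1) := fun l => hk1.trans (hV.monotone (by omega))
  set Y : ℕ → Ω → ℝ := fun l ω => truncLLR μ₁ μ₀ M d (X (V (k + l + 1)) ω) with hY
  have hYm : ∀ l, Measurable (Y l) := fun l =>
    (measurable_truncLLR μ₁ μ₀ M d).comp (h.measurable_X _)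
  have hlaw : ∀ l, Measure.map (X (V (k + l + 1))) Q = μ₁ := fun l =>
    h.law_after m _ hm (hafter l)
  have hint : ∀ l, Integrable (Y l) Q := fun l =>
    (integrable_map_measure (measurable_truncLLR μ₁ μ₀ M d).aestronglyMeasurable
      (h.measurable_X _).aemeasurable).1 (by rw [hlaw]; exact integrable_truncLLR hllr M d)
  have hmean : ∀ l, ∫ ω, Y l ω ∂Q = μ := fun l => by
    rw [← hμe, ← hlaw l, integral_map (h.measurable_X _).aemeasurable
      (measurable_truncLLR _ _ M d).aestronglyMeasurable, hlaw l]
  have hind : iIndepFun Y Q := by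
    have hinj : Function.Injective fun l : ℕ => V (k + l + 1) - 1 := by
      intro i j hij
      have h1 := hpos (k + i)
      have h2 := hpos (k + j)
      have h3 : V (k + i + 1) = V (k + j + 1) := by simp only at hij; omega
      have := hV.injective h3
      omega
    have := ((h.indep m hm).precomp hinj).comp (fun _ => truncLLR μ₁ μ₀ M d)
      fun _ => measurable_truncLLR μ₁ μ₀ M d
    have heq : (fun l => truncLLR μ₁ μ₀ M d ∘ X (V (k + l + 1) - 1 + 1)) = Y := by
      funext l; rw [Nat.sub_add_cancel (hpos _)]; rfl
    rwa [heq] at this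
  have hwald : ∑' j, Q (belowLevel Y b j) ≤ ENNReal.ofReal ((b + (M + d)) / μ) :=
    tsum_measure_belowLevel_le hYm hind hb.le (add_nonneg hM hd0) hμ hint hmean
      fun j ω => add_le_add_left (min_le_right _ _) _
  have hposterior : ∀ᵐ ω ∂Q, ∀ N, m ≤ V N → ENNReal.ofReal ((1 - η) / η * (1 - ρ) ^ V N) ≤
        ENNReal.ofReal (ρ * (1 - ρ) ^ (m - 1)) * ∏ i ∈ Finset.range N, (if V (i + 1) < m then 1 else
          μ₁.rnDeriv μ₀ (X (V (i + 1)) ω)) →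
      1 - η ≤ posterior P t X V (V N) ω := by
    refine cond_absolutelyContinuous.ae_le ?_
    refine ae_all_iff.2 fun N => ?_
    by_cases hN : m ≤ V N
    · filter_upwards [h.le_posterior hρ hac hV0 hV hm hN hη] with ω hω _ using hω
    · exact Eventually.of_forall fun ω hmN => absurd hmN hN
  have hLae : ∀ᵐ ω ∂Q, ∀ i, 0 < μ₁.rnDeriv μ₀ (X (V (k + i + 1)) ω) ∧
      μ₁.rnDeriv μ₀ (X (V (k + i + 1)) ω) < ∞ := by
    refine ae_all_iff.2 fun i => ?_
    refine ae_of_ae_map (p := fun x => 0 < μ₁.rnDeriv μ₀ x ∧ μ₁.rnDeriv μ₀ x < ∞)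
      (h.measurable_X _).aemeasurable ?_
    rw [hlaw]
    exact (Measure.rnDeriv_pos hac).and (hac.ae_le (Measure.rnDeriv_lt_top μ₁ μ₀))
  have hG : ∀ j, MeasurableSet (belowLevel Y b j) := fun j =>
    measurableSet_belowLevel (fun l _ => hYm l) b
  calc ∫⁻ ω, delay (stopT P t X V η ω) (t ω) ∂Q
      ≤ ∫⁻ ω, (ENNReal.ofReal α * (∑' j, (belowLevel Y b j).indicator 1 ω) +
          ENNReal.ofReal (α * m + C)) ∂Q := by
        refine lintegral_mono_ae ?_
        filter_upwards [hposterior, hLae] with ω h1 h2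
        -- The delay is bounded by the stopping time itself; not subtracting `m` only affects terms
        -- independent of `η`.
        refine (delay_le _ _).trans (toENNReal_le_tsum_indicator hα hC hup hkm hb fun j hj hjb => ?_)
        exact stopT_le_of_le_sum hρ hV hβ hlow hm hk1 hk hη M h1 h2 hj hjb
    _ = ENNReal.ofReal α * (∑' j, Q (belowLevel Y b j)) + ENNReal.ofReal (α * m + C) := by
        rw [lintegral_add_right _ measurable_const,
          lintegral_const_mul' _ _ ENNReal.ofReal_ne_top,
          lintegral_tsum fun j => (measurable_one.indicator (hG j)).aemeasurable]
        simp_rw [lintegral_indicator_one (hG _)]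
        simp
    _ ≤ ENNReal.ofReal α * ENNReal.ofReal ((b + (M + d)) / μ) + ENNReal.ofReal (α * m + C) := by
        gcongr
    _ = _ := by
        rw [← ENNReal.ofReal_mul hα.le, ← ENNReal.ofReal_add]
        · exact mul_nonneg hα.le (div_nonneg (add_nonneg hb.le (add_nonneg hM hd0)) hμ.le)
        · positivity

/-! ### Averaging over the change point -/

theorem IsModel.tsum_mul_measure_eq_ne_top {P : Measure Ω} {lam : Measure E}
    {f₀ f₁ : E → ℝ≥0∞} {ρ : ℝ} {t : Ω → ℕ} {X : ℕ → Ω → E} (h : IsModel P lam f₀ f₁ ρ t X)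
    (hρ : ρ ∈ Set.Ioo (0 : ℝ) 1) : ∑' m : ℕ, (m : ℝ≥0∞) * P {ω | t ω = m} ≠ ∞ := by
  have hρ' : 0 < 1 - ρ := by linarith [hρ.2]
  have hs : Summable fun m : ℕ => (m : ℝ) * (ρ * (1 - ρ) ^ (m - 1)) := by
    rw [← summable_nat_add_iff 1]
    have h1 := summable_pow_mul_geometric_of_norm_lt_one 1 (r := 1 - ρ) (by
      rw [Real.norm_eq_abs, abs_of_pos hρ']; linarith [hρ.1])
    have h2 := summable_pow_mul_geometric_of_norm_lt_one 0 (r := 1 - ρ) (by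
      rw [Real.norm_eq_abs, abs_of_pos hρ']; linarith [hρ.1])
    refine ((h1.add h2).mul_left ρ).congr fun m => ?_
    simp only [add_tsub_cancel_right]
    push_cast
    ring
  refine ne_top_of_le_ne_top hs.tsum_ofReal_ne_top (ENNReal.tsum_le_tsum fun m => ?_)
  rcases Nat.eq_zero_or_pos m with rfl | hm
  · simp
  · rw [h.prior m hm, ENNReal.ofReal_mul (Nat.cast_nonneg m), ENNReal.ofReal_natCast]

theorem IsModel.ADD_le {P : Measure Ω} [IsProbabilityMeasure P] {lam : Measure E}
    {f₀ f₁ : E → ℝ≥0∞} {ρ : ℝ} {t : Ω → ℕ} {X : ℕ → Ω → E} (h : IsModel P lam f₀ f₁ ρ t X)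
    (hρ : ρ ∈ Set.Ioo (0 : ℝ) 1) [IsProbabilityMeasure (lam.withDensity f₀)]
    [IsProbabilityMeasure (lam.withDensity f₁)]
    (hac : lam.withDensity f₁ ≪ lam.withDensity f₀)
    (hllr : Integrable (llr (lam.withDensity f₁) (lam.withDensity f₀)) (lam.withDensity f₁))
    {V : ℕ → ℕ} (hV0 : V 0 = 0) (hV : StrictMono V)
    {α β C : ℝ} (hα : 0 < α) (hβ : 0 ≤ β) (hC : 0 ≤ C) (hlow : ∀ N : ℕ, β * N - C ≤ V N)
    (hup : ∀ N : ℕ, (V N : ℝ) ≤ α * N + C) {M : ℝ} (hM : 0 ≤ M) {μ : ℝ} (hμ : 0 < μ)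
    (hμe : ∫ x, truncLLR (lam.withDensity f₁) (lam.withDensity f₀) M (-Real.log (1 - ρ) * β) x
      ∂lam.withDensity f₁ = μ) :
    ∃ K : ℝ, 0 ≤ K ∧ ∀ η ∈ Set.Ioo (0 : ℝ) 1,
      ADD P t X V η ≤ ENNReal.ofReal (α / μ * |Real.log η| + K) := by
  have hc : Real.log (1 - ρ) < 0 := Real.log_neg (by linarith [hρ.2]) (by linarith [hρ.1])
  have hlρ := Real.log_neg hρ.1 hρ.2
  set c := -Real.log (1 - ρ) with hcdef
  have hc0 : 0 < c := by linarith
  -- The conditional bound regrouped as `α / μ * |log η| + K₀ + K₁ * m`.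
  set K₀ := α * ((-Real.log ρ + c * C + (M + c * β)) / μ) + C with hK₀
  set K₁ := α * (c / μ + 1) with hK₁
  have hK₀0 : 0 ≤ K₀ := by
    have : 0 ≤ -Real.log ρ := by linarith
    positivity
  have hK₁0 : 0 ≤ K₁ := by positivity
  set S := ∑' m : ℕ, (m : ℝ≥0∞) * P {ω | t ω = m} with hS
  have hSt : S ≠ ∞ := h.tsum_mul_measure_eq_ne_top hρ
  refine ⟨K₀ + K₁ * S.toReal, by positivity, fun η hη => ?_⟩
  have hlη := Real.log_neg hη.1 hη.2
  have hU : ⋃ m : ℕ, {ω | t ω = m} = Set.univ := by ext ω; simp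
  have hd : Pairwise (Function.onFun Disjoint fun m : ℕ => {ω | t ω = m}) := fun a b hab =>
    Set.disjoint_left.2 fun ω ha hb => hab (Eq.trans (Eq.symm ha) hb)
  have hone : ∑' m : ℕ, P {ω | t ω = m} = 1 := by
    rw [← measure_iUnion hd h.measurableSet_eq, hU, measure_univ]
  have hA0 : 0 ≤ α / μ * |Real.log η| + K₀ := by positivity
  calc ADD P t X V η
      = ∑' m : ℕ, ∫⁻ ω in {ω | t ω = m}, delay (stopT P t X V η ω) (t ω) ∂P := by
        rw [ADD, ← lintegral_iUnion h.measurableSet_eq hd, hU, Measure.restrict_univ]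
    _ ≤ ∑' m : ℕ, (ENNReal.ofReal (α / μ * |Real.log η| + K₀) * P {ω | t ω = m} +
          ENNReal.ofReal K₁ * (m * P {ω | t ω = m})) := by
        refine ENNReal.tsum_le_tsum fun m => ?_
        rcases Nat.eq_zero_or_pos m with rfl | hm
        · rw [setLIntegral_measure_zero _ _ (h.measure_eq_zero hρ)]
          exact zero_le
        · rw [setLIntegral_eq_mul_lintegral_cond (h.measure_eq_ne_zero hρ hm)]
          refine (mul_le_mul_right (h.lintegral_delay_cond_le hρ hac hllr hV0 hV hα hβ hC hlow hup hM
            hμ hμe hη hm) _).trans (le_of_eq ?_)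
          have e : α * ((-Real.log η - Real.log ρ - Real.log (1 - ρ) * (m + C) +
              (M + -Real.log (1 - ρ) * β)) / μ) + (α * m + C) =
              α / μ * |Real.log η| + K₀ + K₁ * m := by
            rw [abs_of_neg hlη, hK₀, hK₁, hcdef]
            field_simp
            ring
          rw [e, ENNReal.ofReal_add hA0 (by positivity), ENNReal.ofReal_mul hK₁0,
            ENNReal.ofReal_natCast]
          ring
    _ = ENNReal.ofReal (α / μ * |Real.log η| + K₀) + ENNReal.ofReal K₁ * S := by
        rw [ENNReal.tsum_add, ENNReal.tsum_mul_left, ENNReal.tsum_mul_left, hone, mul_one]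
    _ = ENNReal.ofReal (α / μ * |Real.log η| + (K₀ + K₁ * S.toReal)) := by
        rw [← add_assoc (α / μ * |Real.log η|) K₀, ENNReal.ofReal_add hA0 (by positivity), ENNReal.ofReal_mul hK₁0,
          ENNReal.ofReal_toReal hSt]

/-! ### Optimizing the slope -/

theorem integral_truncLLR {μ ν : Measure E} [IsProbabilityMeasure μ]
    (h : Integrable (llr μ ν) μ) (M d : ℝ) :
    ∫ x, truncLLR μ ν M d x ∂μ = ∫ x, min (llr μ ν x) M ∂μ + d := by
  have := integral_add (h.inf (integrable_const M)) (integrable_const d)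
  simpa [truncLLR] using this

theorem tendsto_integral_min {μ : Measure E} [IsFiniteMeasure μ] {f : E → ℝ} (hf : Integrable f μ) :
    Tendsto (fun n : ℕ => ∫ x, min (f x) n ∂μ) atTop (𝓝 (∫ x, f x ∂μ)) := by
  refine tendsto_integral_of_dominated_convergence (fun x => |f x|)
    (fun n => (hf.inf (integrable_const (n : ℝ))).aestronglyMeasurable) hf.abs
    (fun n => Eventually.of_forall fun x => ?_) (Eventually.of_forall fun x => ?_)
  · rw [Real.norm_eq_abs, abs_le]
    have hn : (0 : ℝ) ≤ n := Nat.cast_nonneg n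
    exact ⟨le_min (neg_abs_le _) ((neg_nonpos.2 (abs_nonneg _)).trans hn),
      (min_le_left _ _).trans (le_abs_self _)⟩
  · refine tendsto_const_nhds.congr' ?_
    filter_upwards [eventually_ge_atTop ⌈f x⌉₊] with n hn
    exact (min_eq_left (Nat.ceil_le.1 hn)).symm

/-- For every slope above the optimal one, the average detection delay is at most affine in
`|log η|`. -/
theorem IsModel.exists_ADD_le {P : Measure Ω} [IsProbabilityMeasure P] {lam : Measure E}
    {f₀ f₁ : E → ℝ≥0∞} {ρ : ℝ} {t : Ω → ℕ} {X : ℕ → Ω → E} (h : IsModel P lam f₀ f₁ ρ t X)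
    (hρ : ρ ∈ Set.Ioo (0 : ℝ) 1) [IsProbabilityMeasure (lam.withDensity f₀)]
    [IsProbabilityMeasure (lam.withDensity f₁)]
    (hac : lam.withDensity f₁ ≪ lam.withDensity f₀)
    (hllr : Integrable (llr (lam.withDensity f₁) (lam.withDensity f₀)) (lam.withDensity f₁))
    {V : ℕ → ℕ} (hV0 : V 0 = 0) (hV : StrictMono V) {ζ : ℝ} (hζ : 1 ≤ ζ)
    (hmean : Tendsto (meanGap V) atTop (𝓝 ζ)) {D : ℝ} (hD0 : 0 ≤ D)
    (hD : ∫ x, llr (lam.withDensity f₁) (lam.withDensity f₀) x ∂lam.withDensity f₁ = D) {A : ℝ}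
    (hA : ζ / (D + -Real.log (1 - ρ) * ζ) < A) :
    ∃ K : ℝ, 0 ≤ K ∧ ∀ η ∈ Set.Ioo (0 : ℝ) 1,
      ADD P t X V η ≤ ENNReal.ofReal (A * |Real.log η| + K) := by
  have hc : Real.log (1 - ρ) < 0 := Real.log_neg (by linarith [hρ.2]) (by linarith [hρ.1])
  set c := -Real.log (1 - ρ) with hcdef
  have hc0 : 0 < c := by linarith
  set μ₀ := lam.withDensity f₀
  set μ₁ := lam.withDensity f₁
  have hpos : 0 < D + c * ζ := by positivity
  have hε : Tendsto (fun n : ℕ => 1 / ((n : ℝ) + 1)) atTop (𝓝 0) :=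
    tendsto_one_div_add_atTop_nhds_zero_nat
  have hden : Tendsto (fun n : ℕ => ∫ x, min (llr μ₁ μ₀ x) n ∂μ₁ + c * (ζ - 1 / ((n : ℝ) + 1)))
      atTop (𝓝 (D + c * ζ)) := by
    have h1 := tendsto_integral_min hllr
    rw [hD] at h1
    simpa using h1.add ((tendsto_const_nhds.sub hε).const_mul c)
  have hratio : Tendsto (fun n : ℕ => (ζ + 1 / ((n : ℝ) + 1)) /
      (∫ x, min (llr μ₁ μ₀ x) n ∂μ₁ + c * (ζ - 1 / ((n : ℝ) + 1)))) atTop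
      (𝓝 (ζ / (D + c * ζ))) := by
    have := (tendsto_const_nhds (x := ζ)).add hε
    rw [add_zero] at this
    exact this.div hden hpos.ne'
  -- One `n` sets both the truncation level `M = n` and the gap accuracy `1 / (n + 1)`; it must make
  -- the drift positive and the slope less than `A`.
  obtain ⟨n, hn1, hn2⟩ :=
    ((hden.eventually_const_lt hpos).and (hratio.eventually_lt_const hA)).exists
  have hn0 : (0 : ℝ) < 1 / ((n : ℝ) + 1) := Nat.one_div_pos_of_nat
  -- With `ζ ≥ 1` this makes `β = ζ - 1 / (n + 1)` nonnegative.
  have hnle : 1 / ((n : ℝ) + 1) ≤ 1 := by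
    rw [div_le_one (by positivity)]; linarith [(Nat.cast_nonneg n : (0 : ℝ) ≤ n)]
  obtain ⟨C, hC, hVC⟩ := exists_abs_sub_le hmean hn0
  obtain ⟨K, hK, hbound⟩ := h.ADD_le hρ hac hllr hV0 hV (α := ζ + 1 / ((n : ℝ) + 1))
    (β := ζ - 1 / ((n : ℝ) + 1)) (by linarith) (by linarith) hC
    (fun N => by have := (abs_le.1 (hVC N)).1; linarith)
    (fun N => by have := (abs_le.1 (hVC N)).2; linarith) (M := n) (Nat.cast_nonneg n) hn1 (by
      exact integral_truncLLR hllr n _)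
  refine ⟨K, hK, fun η hη => (hbound η hη).trans (ENNReal.ofReal_le_ofReal ?_)⟩
  gcongr

/-! ### From affine bounds to the asymptotic bound -/

/-- Affine bounds with all slopes above `R` give an asymptotic bound with slope `R`. -/
theorem exists_tendsto_zero_of_affine_bounds {F : ℝ → ℝ≥0∞} {R : ℝ} (hR : 0 < R)
    (hF : ∀ A, R < A → ∃ K : ℝ, 0 ≤ K ∧ ∀ η ∈ Set.Ioo (0 : ℝ) 1,
      F η ≤ ENNReal.ofReal (A * |Real.log η| + K)) :
    ∃ o : ℝ → ℝ, Tendsto o (𝓝[>] 0) (𝓝 0) ∧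
      ∀ᶠ η in 𝓝[>] (0 : ℝ), F η ≤ ENNReal.ofReal (R * |Real.log η| * (1 + o η)) := by
  have hIoo : ∀ᶠ η in 𝓝[>] (0 : ℝ), η ∈ Set.Ioo (0 : ℝ) 1 := Ioo_mem_nhdsGT one_pos
  have hlog : Tendsto (fun η => |Real.log η|) (𝓝[>] 0) atTop :=
    tendsto_abs_atBot_atTop.comp Real.tendsto_log_nhdsGT_zero
  -- The witness is the positive part of the relative excess of `F` over the target.
  refine ⟨fun η => max 0 ((F η).toReal / (R * |Real.log η|) - 1), ?_, ?_⟩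
  · rw [Metric.tendsto_nhds]
    intro δ hδ
    -- Half of `δ` goes to the slope, the other half absorbs `K` once `|log η|` is large.
    obtain ⟨K, hK, hb⟩ := hF (R * (1 + δ / 2)) (by nlinarith)
    filter_upwards [hIoo, hlog.eventually_gt_atTop (K / (R * (δ / 2)))] with η hη hl
    have hl0 : 0 < |Real.log η| := lt_of_le_of_lt (by positivity) hl
    rw [Real.dist_eq, sub_zero, abs_of_nonneg (le_max_left _ _)]
    refine max_lt hδ ?_
    rw [sub_lt_iff_lt_add, div_lt_iff₀ (by positivity)]
    rw [div_lt_iff₀ (by positivity)] at hl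
    have := ENNReal.toReal_mono ENNReal.ofReal_ne_top (hb η hη)
    rw [ENNReal.toReal_ofReal (by positivity)] at this
    nlinarith
  · filter_upwards [hIoo] with η hη
    -- Any slope above `R` would do: only the finiteness of `F η` is needed.
    obtain ⟨K, _, hb⟩ := hF (R + 1) (by linarith)
    have hl0 : 0 < |Real.log η| := abs_pos.2 (Real.log_neg hη.1 hη.2).ne
    refine (ENNReal.le_ofReal_iff_toReal_le
      (ne_top_of_le_ne_top ENNReal.ofReal_ne_top (hb η hη)) (by positivity)).2 ?_
    rw [← div_le_iff₀' (by positivity)]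
    linarith [le_max_right 0 ((F η).toReal / (R * |Real.log η|) - 1)]

end ChangePoint

theorem proposition1 {Ω E : Type*} [MeasurableSpace Ω] [MeasurableSpace E]
    (P : Measure Ω) [IsProbabilityMeasure P]
    (lam : Measure E) [SigmaFinite lam]
    (f₀ f₁ : E → ℝ≥0∞) (hf₀ : Measurable f₀) (hf₁ : Measurable f₁)
    (hf₀_one : ∫⁻ x, f₀ x ∂lam = 1) (hf₁_one : ∫⁻ x, f₁ x ∂lam = 1)
    (hD : InformationTheory.klDiv (lam.withDensity f₁) (lam.withDensity f₀) ≠ ∞)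
    (ρ : ℝ) (hρ : ρ ∈ Set.Ioo (0 : ℝ) 1)
    (t : Ω → ℕ) (X : ℕ → Ω → E)
    (hmodel : ChangePoint.IsModel P lam f₀ f₁ ρ t X)
    (V : ℕ → ℕ) (hV0 : V 0 = 0) (hV : ∀ n, V n < V (n + 1))
    (B : ℝ) (hB : ∀ n, (V (n + 1) : ℝ) - V n ≤ B)
    (ζ : ℝ) (hζ : ζ ∈ Set.Icc 1 B)
    (hmean : Tendsto (ChangePoint.meanGap V) atTop (𝓝 ζ))
    (hexp : ∃ o : ℝ → ℝ, Tendsto o (𝓝[>] 0) (𝓝 0) ∧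
      ∀ᶠ η in 𝓝[>] (0 : ℝ),
        ∫⁻ ω, ChangePoint.meanGapAt V (ChangePoint.stopΓ P t X V η ω) *
            ChangePoint.delay (ChangePoint.stopΓ P t X V η ω) (ChangePoint.changeγ t V ω) ∂P =
          ENNReal.ofReal ζ *
            (∫⁻ ω, ChangePoint.delay (ChangePoint.stopΓ P t X V η ω)
              (ChangePoint.changeγ t V ω) ∂P) * ENNReal.ofReal (1 + o η)) :
    ∃ o : ℝ → ℝ, Tendsto o (𝓝[>] 0) (𝓝 0) ∧
      ∀ᶠ η in 𝓝[>] (0 : ℝ),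
        ChangePoint.ADD P t X V η ≤
          ENNReal.ofReal
            (|Real.log η| /
              (1 / ζ * (InformationTheory.klDiv (lam.withDensity f₁)
                (lam.withDensity f₀)).toReal + |Real.log (1 - ρ)|) * (1 + o η)) := by
  have hP₀ : IsProbabilityMeasure (lam.withDensity f₀) := ⟨by simpa using hf₀_one⟩
  have hP₁ : IsProbabilityMeasure (lam.withDensity f₁) := ⟨by simpa using hf₁_one⟩
  obtain ⟨hac, hllr⟩ := InformationTheory.klDiv_ne_top_iff.1 hD
  -- Both measures have mass one, so the mass correction in `klDiv` vanishes and the divergence is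
  -- the integral of `llr`.
  have hDe := InformationTheory.toReal_klDiv_of_measure_eq hac (by simp)
  set D := (InformationTheory.klDiv (lam.withDensity f₁) (lam.withDensity f₀)).toReal
  have hD0 : 0 ≤ D := ENNReal.toReal_nonneg
  have hc : Real.log (1 - ρ) < 0 := Real.log_neg (by linarith [hρ.2]) (by linarith [hρ.1])
  have hζ0 : 0 < ζ := by linarith [hζ.1]
  have hden : 0 < D + -Real.log (1 - ρ) * ζ :=
    add_pos_of_nonneg_of_pos hD0 (mul_pos (by linarith) hζ0)
  obtain ⟨o, ho, hb⟩ := ChangePoint.exists_tendsto_zero_of_affine_bounds (div_pos hζ0 hden)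
    fun A hA => hmodel.exists_ADD_le hρ hac hllr hV0 (strictMono_nat_of_lt_succ hV) hζ.1 hmean hD0
      hDe.symm hA
  refine ⟨o, ho, hb.mono fun η hη => hη.trans (le_of_eq ?_)⟩
  have e : |Real.log η| / (1 / ζ * D + |Real.log (1 - ρ)|) =
      ζ / (D + -Real.log (1 - ρ) * ζ) * |Real.log η| := by
    rw [abs_of_neg hc]
    have : 1 / ζ * D + -Real.log (1 - ρ) = (D + -Real.log (1 - ρ) * ζ) / ζ := by
      field_simp
    rw [this]
    field_simp
  rw [e]
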